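/- Let $\mathsf k$ be a field. All algebras are commutative. A partition of $n$ is written $P=(p_1\ge p_2\ge\cdots)$; for partitions $P,P'$ of the same integer, $P\le P'$ (dominance order) means $\sum_{s\le i}p_s\le\sum_{s\le i}p'_s$ for all $i$; $P^\vee$ is the conjugate partition. For a nilpotent $\mathsf k$-linear endomorphism of a finite-dimensional vector space, the Jordan type is the partition given by the sizes of its Jordan blocks; $P_{\ell,M}$ is the Jordan type of multiplication by $\ell$ on $M$ (in each case below multiplication by $\ell$ is nilpotent and has a Jordan type). For a finitely supported sequence $H=(h_0,h_1,\ldots)$ of non-negative integers with $n=\sum_i h_i$, let $P(H)=H^\vee$ be the conjugate of the partition of $n$ formed by the nonzero values of $H$, and let $\mathsf P(H)$ be the partition of $n$ whose conjugate has $k$-th part $r_{k-1}-r_k$ ($k\ge 1$), where $r_k=\sum_{i\ge 0}\min\{h_i,h_{i+1},\ldots,h_{i+k}\}$. (i) Let $A=\bigoplus_{i\ge0}A_i$ be a (possibly non-standard) graded Artinian $\mathsf k$-algebra with $A_0=\mathsf k$, let $M=\bigoplus_{i\ge 0}M_i$ be a graded $A$-module of finite length, with Hilbert function $H=H(M)$,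 $h_i=\dim_{\mathsf k}M_i$, and let $\ell\in A_1$. Then $$P_{\ell,M}\le \mathsf P(H)\le P(H)=H^\vee .$$ (i′) Let $A$ be as in (i), let $\mathfrak m_A=\bigoplus_{i\ge1}A_i$, and let $\ell\in\mathfrak m_A$ be arbitrary (possibly non-homogeneous). Then $$P_{\ell,A}\le H(\mathrm{Gr}_{\mathfrak m_A}A)^\vee,$$ where $H(\mathrm{Gr}_{\mathfrak m_A}A)$ is the sequence $i\mapsto\dim_{\mathsf k}\mathfrak m_A^i/\mathfrak m_A^{i+1}$. (ii) Let $\mathcal A$ be a local Artinian $\mathsf k$-algebra with maximal ideal $\mathfrak m$ and $\mathcal A/\mathfrak m=\mathsf k$, let $M$ be an $\mathcal A$-module of finite length, with $\mathfrak m$-adic Hilbert function $H=H(M)$, $h_i=\dim_{\mathsf k}\mathfrak m^iM/\mathfrak m^{i+1}M$, and let $\ell\in\mathfrak m$. Then $$P_{\ell,M}\le P(H)=H^\vee .$$ -/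

import Mathlib

namespace JordanHilbert

/-! Partitions are Mathlib's Young diagrams: the `i`-th part (from `0`) of `μ` is `μ.rowLen i`,
and the conjugate partition is `μ.transpose`. -/

/-- The dominance order `μ ≤ ν` on partitions of the same integer. -/
def DominanceLE (μ ν : YoungDiagram) : Prop :=
  μ.card = ν.card ∧
    ∀ i : ℕ, ∑ j ∈ Finset.range i, μ.rowLen j ≤ ∑ j ∈ Finset.range i, ν.rowLen j

/-- `μ` is the Jordan type of the (nilpotent) endomorphism `f`: in a suitable basis `f` is a direct
sum of nilpotent Jordan blocks, one for each row of `μ`, of size the length of that row. The basis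
is indexed by the cells of `μ`, and `f` moves each basis vector to the next cell of its row, and
the last one of the row to `0`. -/
def IsJordanType {k V : Type*} [Field k] [AddCommGroup V] [Module k V]
    (f : V →ₗ[k] V) (μ : YoungDiagram) : Prop :=
  ∃ b : Module.Basis {c : ℕ × ℕ // c ∈ μ} k V,
    ∀ c : {c : ℕ × ℕ // c ∈ μ},
      f (b c) = if h : (c.1.1, c.1.2 + 1) ∈ μ then b ⟨(c.1.1, c.1.2 + 1), h⟩ else 0

/-- A sequence of natural numbers with finite support, as a finitely supported function
(and `0` if the support is infinite). -/
noncomputable def finiteSequence (h : ℕ → ℕ) : ℕ →₀ ℕ :=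
  open scoped Classical in
  if hf : (Function.support h).Finite then Finsupp.ofSupportFinite h hf else 0

/-- The Hilbert function `i ↦ dim_k M_i` of a graded vector space `M = ⨁ M_i`. -/
noncomputable def gradedHilbertFunction {k M : Type*} [Field k] [AddCommGroup M] [Module k M]
    (ℳ : ℕ → Submodule k M) : ℕ →₀ ℕ :=
  finiteSequence fun i => Module.finrank k (ℳ i)

/-- The piece `I ^ i M / I ^ (i + 1) M` of the associated graded module of `M` with respect to the
powers of the ideal `I`. -/
abbrev AssociatedGradedPiece {A : Type*} [CommRing A] (I : Ideal A) (M : Type*) [AddCommGroup M]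
    [Module A M] (i : ℕ) : Type _ :=
  ↥(I ^ i • (⊤ : Submodule A M)) ⧸
    (I ^ (i + 1) • (⊤ : Submodule A M)).submoduleOf (I ^ i • (⊤ : Submodule A M))

/-- The `I`-adic Hilbert function `i ↦ dim_k (I ^ i M / I ^ (i + 1) M)` of the module `M`. -/
noncomputable def adicHilbertFunction (k : Type*) {A : Type*} [Field k] [CommRing A] [Algebra k A]
    (I : Ideal A) (M : Type*) [AddCommGroup M] [Module A M] [Module k M] [IsScalarTower k A M] :
    ℕ →₀ ℕ :=
  finiteSequence fun i => Module.finrank k (AssociatedGradedPiece I M i)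

/-- The Ferrers diagram of the nonzero values of `H`, in non-increasing order. -/
noncomputable def ferrersDiagram (H : ℕ →₀ ℕ) : YoungDiagram :=
  YoungDiagram.ofRowLens ((H.support.val.map H).sort (· ≥ ·))
    (Multiset.pairwise_sort _ _).sortedGE

/-- The partition `P(H) = H^∨`, conjugate to the partition formed by the values of `H`. -/
noncomputable def conjugatePartition (H : ℕ →₀ ℕ) : YoungDiagram :=
  (ferrersDiagram H).transpose

/-- `min {h_i, h_{i+1}, …, h_{i+k}}`. -/
def windowMin (H : ℕ →₀ ℕ) (i k : ℕ) : ℕ :=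
  (Finset.Icc i (i + k)).inf' (Finset.nonempty_Icc.mpr (Nat.le_add_right i k)) H

/-- `∑_i min {h_i, h_{i+1}, …, h_{i+k}}`, the largest rank that the `k`-th power of a degree-one
endomorphism of a graded vector space with Hilbert function `H` can have (all terms with
`i` outside of the support of `H` vanish). -/
def rankBound (H : ℕ →₀ ℕ) (k : ℕ) : ℕ :=
  ∑ i ∈ H.support, windowMin H i k

theorem windowMin_le_left (H : ℕ →₀ ℕ) (i k : ℕ) : windowMin H i k ≤ H i :=
  Finset.inf'_le _ (by simp)

theorem windowMin_succ (H : ℕ →₀ ℕ) (i k : ℕ) :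
    windowMin H i (k + 1) = min (windowMin H i k) (H (i + (k + 1))) := by
  apply eq_of_forall_le_iff
  intro c
  simp only [windowMin, Finset.le_inf'_iff, le_min_iff, Finset.mem_Icc]
  constructor
  · intro h
    exact ⟨fun j hj => h j ⟨hj.1, by omega⟩, h _ ⟨by omega, le_rfl⟩⟩
  · rintro ⟨h1, h2⟩ j hj
    by_cases hjk : j = i + (k + 1)
    · exact hjk ▸ h2
    · exact h1 j ⟨hj.1, by omega⟩

theorem windowMin_succ' (H : ℕ →₀ ℕ) (i k : ℕ) :
    windowMin H i (k + 1) = min (H i) (windowMin H (i + 1) k) := by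
  apply eq_of_forall_le_iff
  intro c
  simp only [windowMin, Finset.le_inf'_iff, le_min_iff, Finset.mem_Icc]
  constructor
  · intro h
    exact ⟨h _ ⟨le_rfl, by omega⟩, fun j hj => h j ⟨by omega, by omega⟩⟩
  · rintro ⟨h1, h2⟩ j hj
    by_cases hji : j = i
    · exact hji ▸ h1
    · exact h2 j ⟨by omega, by omega⟩

theorem rankBound_eq_sum_range (H : ℕ →₀ ℕ) {N : ℕ} (hN : H.support ⊆ Finset.range N) (k : ℕ) :
    rankBound H k = ∑ i ∈ Finset.range N, windowMin H i k := by
  refine Finset.sum_subset hN fun i _ hi => ?_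
  have h1 := windowMin_le_left H i k
  have h2 : H i = 0 := by simpa using hi
  omega

theorem rankBound_succ_le (H : ℕ →₀ ℕ) (k : ℕ) : rankBound H (k + 1) ≤ rankBound H k :=
  Finset.sum_le_sum fun i _ => by rw [windowMin_succ]; exact min_le_left _ _

theorem rankBound_eq_zero (H : ℕ →₀ ℕ) {k : ℕ} (hk : H.support ⊆ Finset.range k) :
    rankBound H k = 0 := by
  refine Finset.sum_eq_zero fun i _ => ?_
  have h1 : windowMin H i k ≤ H (i + k) := Finset.inf'_le _ (by simp)
  have h2 : H (i + k) = 0 := by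
    by_contra h
    have := Finset.mem_range.mp (hk (Finsupp.mem_support_iff.mpr h))
    omega
  omega

theorem rankBound_convex (H : ℕ →₀ ℕ) (k : ℕ) :
    rankBound H (k + 1) + rankBound H (k + 1) ≤ rankBound H k + rankBound H (k + 2) := by
  obtain ⟨N, hN⟩ := H.support.exists_nat_subset_range
  have hN' : H.support ⊆ Finset.range (N + 1) :=
    hN.trans (Finset.range_subset_range.mpr (Nat.le_succ N))
  have e0 := rankBound_eq_sum_range H hN' k
  have e1 := rankBound_eq_sum_range H hN' (k + 1)
  have e1' := rankBound_eq_sum_range H hN (k + 1)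
  have e2 := rankBound_eq_sum_range H hN (k + 2)
  rw [Finset.sum_range_succ'] at e0 e1
  have h0 : windowMin H 0 (k + 1) ≤ windowMin H 0 k := by
    rw [windowMin_succ]; exact min_le_left _ _
  have key : ∑ i ∈ Finset.range N, (windowMin H (i + 1) (k + 1) + windowMin H i (k + 1)) ≤
      ∑ i ∈ Finset.range N, (windowMin H (i + 1) k + windowMin H i (k + 2)) := by
    refine Finset.sum_le_sum fun i _ => ?_
    have a1 := windowMin_succ H (i + 1) k
    have a2 := windowMin_succ' H i k
    have a3 : windowMin H i (k + 2) = min (H i) (windowMin H (i + 1) (k + 1)) :=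
      windowMin_succ' H i (k + 1)
    omega
  rw [Finset.sum_add_distrib, Finset.sum_add_distrib] at key
  omega

theorem rankBound_sub_antitone (H : ℕ →₀ ℕ) :
    Antitone fun k => rankBound H k - rankBound H (k + 1) := by
  refine antitone_nat_of_succ_le fun k => ?_
  have h1 := rankBound_convex H k
  have h2 := rankBound_succ_le H k
  have h3 := rankBound_succ_le H (k + 1)
  show rankBound H (k + 1) - rankBound H (k + 2) ≤ rankBound H k - rankBound H (k + 1)
  omega

/-- The partition `𝖯(H)` that corresponds to equality in the rank bounds
`rank ℓ ^ k ≤ ∑_i min {h_i, …, h_{i+k}}`: the partition whose conjugate is the first difference of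
the sequence `rankBound H`, i.e. whose `k`-th column has length
`rankBound H k - rankBound H (k + 1)`. -/
def barPartition (H : ℕ →₀ ℕ) : YoungDiagram where
  cells := (Finset.range (rankBound H 0) ×ˢ Finset.range (H.support.sup id + 1)).filter
    fun c => c.1 < rankBound H c.2 - rankBound H (c.2 + 1)
  isLowerSet := by
    rintro ⟨i, j⟩ ⟨i', j'⟩ ⟨hi, hj⟩ h
    simp only [Finset.coe_filter, Finset.mem_product, Finset.mem_range, Set.mem_ofPred_eq] at *
    have := rankBound_sub_antitone H hj
    simp only at this
    omega

theorem mem_barPartition (H : ℕ →₀ ℕ) (i j : ℕ) :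
    (i, j) ∈ barPartition H ↔ i < rankBound H j - rankBound H (j + 1) := by
  rw [← YoungDiagram.mem_cells]
  simp only [barPartition, Finset.mem_filter, Finset.mem_product, Finset.mem_range,
    and_iff_right_iff_imp]
  intro h
  have h1 : rankBound H j ≤ rankBound H 0 :=
    antitone_nat_of_succ_le (rankBound_succ_le H) (Nat.zero_le j)
  refine ⟨by omega, ?_⟩
  by_contra hj
  have : rankBound H j = 0 := rankBound_eq_zero H fun x hx => by
    have : x ≤ H.support.sup id := Finset.le_sup (f := id) hx
    rw [Finset.mem_range]
    omega
  omega

/-- The columns of `barPartition H` have the intended lengths. -/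
theorem colLen_barPartition (H : ℕ →₀ ℕ) (j : ℕ) :
    (barPartition H).colLen j = rankBound H j - rankBound H (j + 1) := by
  apply eq_of_forall_lt_iff
  intro i
  rw [← YoungDiagram.mem_iff_lt_colLen, mem_barPartition]

end JordanHilbert

namespace JordanHilbert

/-! Dominance is tested on column tails. Let t_k(μ) be the number of cells of μ in columns of index
at least k. Rows 0, ..., i-1 contain at most i*k + t_k(μ) cells, with equality when k is the length
of row i; so for diagrams of equal size t_k(μ) ≤ t_k(ν) for all k implies μ ≤ ν
(`dominanceLE_of_tailCard_le`). Each tail has a meaning: for a Jordan type of f it is at most rank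
f^k, for 𝖯(H) it is `rankBound H k`, and for H^∨ it is the sum of the values of H with the k largest
removed.

If f raises degrees by one, f^k restricted to M_i passes through M_i, ..., M_{i+k}, so its rank is
at most the smallest of their dimensions; summing over i gives `rankBound`. Both bounds by H^∨ come
from one induction, `le_sum_sdiff_of_step`. For a filtration F with f(F a) ⊆ F (a+1), passing from F
a to F (a+1) either costs H a dimensions or uses up one factor f; using the k factors at the k
largest values leaves exactly the tail of H^∨.

Jordan types exist by the structure theorem over k[X]. A graded Artinian algebra with A_0 = k is
local with maximal ideal A_+, so the statement for arbitrary elements of A_+ is the local one with M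
= A. -/

/-! ### Dominance and column tails -/

/-- The number of cells of `μ` in the columns of index at least `k`. -/
def tailCard (μ : YoungDiagram) (k : ℕ) : ℕ :=
  (μ.cells.filter fun c => k ≤ c.2).card

theorem tailCard_zero (μ : YoungDiagram) : tailCard μ 0 = μ.card := by
  simp [tailCard, YoungDiagram.card]

theorem sum_rowLen_range (μ : YoungDiagram) (i : ℕ) :
    ∑ j ∈ Finset.range i, μ.rowLen j = (μ.cells.filter fun c => c.1 < i).card := by
  rw [Finset.card_eq_sum_card_fiberwise (f := Prod.fst) (t := Finset.range i)]
  · refine Finset.sum_congr rfl fun j hj => ?_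
    rw [YoungDiagram.rowLen_eq_card]
    congr 1
    ext c
    simp only [YoungDiagram.row, Finset.mem_filter, Finset.mem_range] at *
    grind
  · intro c hc
    simpa using (Finset.mem_filter.mp hc).2

theorem card_filter_eq_sum_colLen (μ : YoungDiagram) (p : ℕ × ℕ → Prop) [DecidablePred p]
    {N : ℕ} (hN : ∀ c ∈ μ, c.2 < N) :
    (μ.cells.filter p).card =
      ∑ j ∈ Finset.range N, ((Finset.range (μ.colLen j)).filter fun i => p (i, j)).card := by
  rw [Finset.card_eq_sum_card_fiberwise (f := Prod.snd) (t := Finset.range N)]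
  · refine Finset.sum_congr rfl fun j _ => ?_
    refine Finset.card_bij (fun c _ => c.1) ?_ ?_ ?_
    · rintro ⟨a, b⟩ h
      simp only [Finset.mem_filter, YoungDiagram.mem_cells, YoungDiagram.mem_iff_lt_colLen,
        Finset.mem_range] at *
      grind
    · rintro ⟨a, b⟩ h ⟨a', b'⟩ h'
      simp only [Finset.mem_filter] at *
      grind
    · intro a h
      refine ⟨(a, j), ?_, rfl⟩
      simpa [YoungDiagram.mem_iff_lt_colLen] using h
  · intro c hc
    simpa using hN c (by simpa using (Finset.mem_filter.mp hc).1)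

theorem sum_rowLen_le (μ : YoungDiagram) (i k : ℕ) :
    ∑ j ∈ Finset.range i, μ.rowLen j ≤ i * k + tailCard μ k := by
  rw [sum_rowLen_range]
  calc _ ≤ (Finset.range i ×ˢ Finset.range k ∪ μ.cells.filter fun c => k ≤ c.2).card := by
        refine Finset.card_le_card fun c hc => ?_
        simp only [Finset.mem_filter, Finset.mem_union, Finset.mem_product, Finset.mem_range] at *
        by_cases h : k ≤ c.2
        · exact Or.inr ⟨hc.1, h⟩
        · exact Or.inl ⟨hc.2, by omega⟩
    _ ≤ _ := by
        refine (Finset.card_union_le _ _).trans ?_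
        simp [tailCard]

/-- The bound of `sum_rowLen_le` is attained at k = `μ.rowLen i`: earlier rows are at least this
long, so they contain the whole rectangle, and later rows have no cell in the tail. -/
theorem le_sum_rowLen (μ : YoungDiagram) (i : ℕ) :
    i * μ.rowLen i + tailCard μ (μ.rowLen i) ≤ ∑ j ∈ Finset.range i, μ.rowLen j := by
  rw [sum_rowLen_range]
  have hd : Disjoint (Finset.range i ×ˢ Finset.range (μ.rowLen i))
      (μ.cells.filter fun c => μ.rowLen i ≤ c.2) := by
    rw [Finset.disjoint_left]
    intro c hc hc'
    simp only [Finset.mem_filter, Finset.mem_product, Finset.mem_range] at *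
    omega
  have hcard := Finset.card_union_of_disjoint hd
  rw [Finset.card_product, Finset.card_range, Finset.card_range] at hcard
  rw [tailCard, ← hcard]
  refine Finset.card_le_card fun c hc => ?_
  obtain ⟨a, b⟩ := c
  simp only [Finset.mem_filter, Finset.mem_union, Finset.mem_product, Finset.mem_range,
    YoungDiagram.mem_cells, YoungDiagram.mem_iff_lt_rowLen] at *
  rcases hc with ⟨h1, h2⟩ | ⟨h1, h2⟩
  · have := μ.rowLen_anti a i h1.le
    omega
  · refine ⟨h1, ?_⟩
    by_contra h
    have := μ.rowLen_anti i a (by omega)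
    omega

/-- Dominance can be tested on the numbers of cells in the last columns. -/
theorem dominanceLE_of_tailCard_le {μ ν : YoungDiagram} (hc : μ.card = ν.card)
    (h : ∀ k, tailCard μ k ≤ tailCard ν k) : DominanceLE μ ν :=
  ⟨hc, fun i => (sum_rowLen_le μ i (ν.rowLen i)).trans <|
    (Nat.add_le_add_left (h _) _).trans (le_sum_rowLen ν i)⟩

/-! ### Column tails of 𝖯(H) and of H^∨ -/

theorem tailCard_barPartition (H : ℕ →₀ ℕ) (k : ℕ) :
    tailCard (barPartition H) k = rankBound H k := by
  obtain ⟨N, hN⟩ := H.support.exists_nat_subset_range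
  have hanti := antitone_nat_of_succ_le (rankBound_succ_le H)
  have h0 : ∀ j, N ≤ j → rankBound H j = 0 := fun j hj =>
    rankBound_eq_zero H (hN.trans (Finset.range_subset_range.mpr hj))
  rw [tailCard, card_filter_eq_sum_colLen (barPartition H) (fun c => k ≤ c.2) (N := N)]
  · have hterm : ∀ j, ((Finset.range ((barPartition H).colLen j)).filter fun _ => k ≤ j).card =
        if k ≤ j then rankBound H j - rankBound H (j + 1) else 0 := fun j => by
      by_cases hkj : k ≤ j <;> simp [hkj, colLen_barPartition]
    simp only [hterm]
    -- The column lengths telescope; `max n k` covers n < k, where the sum is still empty.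
    have key : ∀ n, ∑ j ∈ Finset.range n,
        (if k ≤ j then rankBound H j - rankBound H (j + 1) else 0) + rankBound H (max n k) =
          rankBound H k := fun n => by
      induction n with
      | zero => simp
      | succ n ih =>
        rw [Finset.sum_range_succ]
        by_cases hk : k ≤ n
        · rw [max_eq_left hk] at ih
          rw [max_eq_left (show k ≤ n + 1 by omega), if_pos hk]
          have := rankBound_succ_le H n
          omega
        · rw [max_eq_right (by omega)] at ih
          rw [max_eq_right (by omega), if_neg hk]
          omega
    have := key N
    rw [h0 (max N k) (le_max_left _ _)] at this
    simpa using this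
  · rintro ⟨i, j⟩ hc
    rw [mem_barPartition] at hc
    by_contra h
    rw [h0 j (by simpa using h)] at hc
    omega

theorem card_filter_cellsOfRowLens (w : List ℕ) (k : ℕ) :
    ((YoungDiagram.cellsOfRowLens w).filter fun c => k ≤ c.1).card = (w.drop k).sum := by
  induction w generalizing k with
  | nil => simp [YoungDiagram.cellsOfRowLens]
  | cons a w ih =>
    rw [YoungDiagram.cellsOfRowLens, Finset.filter_union, Finset.card_union_of_disjoint,
      Finset.filter_map, Finset.card_map]
    · cases k with
      | zero =>
        have := ih 0
        simp_all
      | succ k =>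
        have h1 : (({0} : Finset ℕ) ×ˢ Finset.range a).filter (fun c => k + 1 ≤ c.1) = ∅ := by
          ext c
          simp only [Finset.mem_filter, Finset.mem_product, Finset.mem_singleton]
          grind
        rw [h1, List.drop_succ_cons, ← ih k]
        simp
    · rw [Finset.disjoint_left]
      intro c hc hc'
      simp only [Finset.mem_filter, Finset.mem_product, Finset.mem_map,
        Finset.mem_singleton] at hc hc'
      obtain ⟨⟨d, -, rfl⟩, -⟩ := hc'
      simp at hc

theorem tailCard_transpose (μ : YoungDiagram) (k : ℕ) :
    tailCard μ.transpose k = (μ.cells.filter fun c => k ≤ c.1).card := by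
  refine Finset.card_bij (fun c _ => c.swap) ?_ ?_ ?_
  · intro c hc
    simpa using hc
  · intro c _ d _ h
    exact Prod.swap_injective h
  · intro c hc
    exact ⟨c.swap, by simpa using hc, by simp⟩

/-- The columns of `H^∨` of index at least `k` contain the values of `H` outside of some set of at
most `k` elements. -/
theorem exists_tailCard_conjugatePartition (H : ℕ →₀ ℕ) (k : ℕ) :
    ∃ S : Finset ℕ, S ⊆ H.support ∧ S.card ≤ k ∧
      tailCard (conjugatePartition H) k = ∑ i ∈ H.support \ S, H i := by
  -- Sorting the indices, not just the values, lets the first k entries of the list serve as S even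
  -- when values repeat.
  set L := H.support.toList.insertionSort (fun a b => H a ≥ H b) with hL
  have hperm : L.Perm H.support.toList := List.perm_insertionSort _ _
  have hnd : L.Nodup := hperm.nodup_iff.mpr (Finset.nodup_toList _)
  have hmap : (H.support.val.map H).sort (· ≥ ·) = L.map H := by
    refine List.Perm.eq_of_pairwise (le := (· ≥ ·)) (fun a b _ _ h1 h2 => le_antisymm h2 h1)
      (Multiset.pairwise_sort _ _) ?_ ?_
    · rw [List.pairwise_map]
      have : Std.Total (fun a b => H a ≥ H b) := ⟨fun a b => le_total (H b) (H a)⟩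
      have : IsTrans ℕ (fun a b => H a ≥ H b) := ⟨fun a b c h1 h2 => le_trans h2 h1⟩
      exact List.pairwise_insertionSort _ _
    · rw [← Multiset.coe_eq_coe, Multiset.sort_eq, ← Multiset.map_coe,
        Multiset.coe_eq_coe.mpr hperm, Finset.coe_toList]
  have hmem : ∀ i, i ∈ L ↔ i ∈ H.support := fun i => by rw [hperm.mem_iff, Finset.mem_toList]
  refine ⟨(L.take k).toFinset, ?_, ?_, ?_⟩
  · intro i hi
    exact (hmem i).mp (List.mem_of_mem_take (List.mem_toFinset.mp hi))
  · exact (List.toFinset_card_le _).trans (List.length_take_le _ _)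
  · have hsd : H.support \ (L.take k).toFinset = (L.drop k).toFinset := by
      have hsplit : L.take k ++ L.drop k = L := List.take_append_drop k L
      have hnd' := hnd
      rw [← hsplit, List.nodup_append'] at hnd'
      ext i
      have happ : i ∈ L ↔ i ∈ L.take k ∨ i ∈ L.drop k := by rw [← List.mem_append, hsplit]
      rw [Finset.mem_sdiff, ← hmem, List.mem_toFinset, List.mem_toFinset, happ]
      have hdisj : i ∈ L.take k → i ∉ L.drop k := fun h h' => hnd'.2.2 h h'
      tauto
    rw [hsd, conjugatePartition, tailCard_transpose, List.sum_toFinset H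
      (hnd.sublist (List.drop_sublist k L)), List.map_drop, ← hmap]
    exact card_filter_cellsOfRowLens _ k

theorem card_conjugatePartition (H : ℕ →₀ ℕ) :
    (conjugatePartition H).card = ∑ i ∈ H.support, H i := by
  obtain ⟨S, -, h2, h3⟩ := exists_tailCard_conjugatePartition H 0
  rw [← tailCard_zero, h3, Finset.card_eq_zero.mp (Nat.le_zero.mp h2), Finset.sdiff_empty]

theorem card_barPartition (H : ℕ →₀ ℕ) :
    (barPartition H).card = ∑ i ∈ H.support, H i := by
  rw [← tailCard_zero, tailCard_barPartition]
  exact Finset.sum_congr rfl fun i _ => by simp [windowMin]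

/-! ### Comparison with H^∨ -/

/-- Walk from a up to N: at an index in S apply `h2`, which lowers k and costs nothing; elsewhere
apply `h1` and pay the value of H. Since S has at most k elements, k never runs out. -/
theorem le_sum_sdiff_of_step (H : ℕ → ℕ) (D : ℕ → ℕ → ℕ) {N : ℕ}
    (h0 : ∀ k, D k N = 0) (h1 : ∀ k a, D k a ≤ H a + D k (a + 1))
    (h2 : ∀ k a, D (k + 1) a ≤ D k (a + 1)) {a : ℕ} (ha : a ≤ N) :
    ∀ (k : ℕ) (S : Finset ℕ), S ⊆ Finset.Ico a N → S.card ≤ k →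
      D k a ≤ ∑ i ∈ Finset.Ico a N \ S, H i := by
  induction ha using Nat.decreasingInduction with
  | self => intro k S _ _; simp [h0]
  | of_succ a ha ih =>
    intro k S hS hk
    by_cases haS : a ∈ S
    · obtain ⟨k, rfl⟩ : ∃ l, k = l + 1 := ⟨k - 1, by
        have := Finset.card_pos.mpr ⟨a, haS⟩
        omega⟩
      refine (h2 k a).trans ((ih k (S.erase a) ?_ ?_).trans_eq ?_)
      · intro i hi
        have := hS (Finset.mem_of_mem_erase hi)
        have := Finset.ne_of_mem_erase hi
        simp only [Finset.mem_Ico] at *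
        omega
      · rw [Finset.card_erase_of_mem haS]
        omega
      · refine Finset.sum_congr ?_ fun _ _ => rfl
        ext i
        simp only [Finset.mem_sdiff, Finset.mem_Ico, Finset.mem_erase]
        grind
    · refine (h1 k a).trans ?_
      have hsplit : Finset.Ico a N \ S = insert a (Finset.Ico (a + 1) N \ S) := by
        ext i
        simp only [Finset.mem_sdiff, Finset.mem_Ico, Finset.mem_insert]
        grind
      rw [hsplit, Finset.sum_insert (by simp)]
      refine Nat.add_le_add_left (ih k S ?_ hk) _
      intro i hi
      have := hS hi
      have : i ≠ a := fun h => haS (h ▸ hi)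
      simp only [Finset.mem_Ico] at *
      omega

theorem le_tailCard_conjugatePartition (H : ℕ →₀ ℕ) (D : ℕ → ℕ → ℕ) {N : ℕ}
    (hN : H.support ⊆ Finset.range N)
    (h0 : ∀ k, D k N = 0) (h1 : ∀ k a, D k a ≤ H a + D k (a + 1))
    (h2 : ∀ k a, D (k + 1) a ≤ D k (a + 1)) (k : ℕ) :
    D k 0 ≤ tailCard (conjugatePartition H) k := by
  obtain ⟨S, hS, hSk, hS'⟩ := exists_tailCard_conjugatePartition H k
  rw [hS']
  refine (le_sum_sdiff_of_step H D h0 h1 h2 (Nat.zero_le N) k S ?_ hSk).trans_eq ?_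
  · rw [← Finset.range_eq_Ico]
    exact hS.trans hN
  · rw [← Finset.range_eq_Ico]
    refine (Finset.sum_subset (Finset.sdiff_subset_sdiff hN le_rfl) fun i hi hi' => ?_).symm
    simp only [Finset.mem_sdiff, Finsupp.mem_support_iff] at hi hi'
    grind

/-- `𝖯(H) ≤ H^∨`. -/
theorem barPartition_dominanceLE_conjugatePartition (H : ℕ →₀ ℕ) :
    DominanceLE (barPartition H) (conjugatePartition H) := by
  obtain ⟨N, hN⟩ := H.support.exists_nat_subset_range
  refine dominanceLE_of_tailCard_le
    ((card_barPartition H).trans (card_conjugatePartition H).symm) fun k => ?_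
  rw [tailCard_barPartition, rankBound_eq_sum_range H hN, Finset.range_eq_Ico]
  have hz : ∀ i, N ≤ i → H i = 0 := fun i hi => by
    by_contra h
    have := Finset.mem_range.mp (hN (Finsupp.mem_support_iff.mpr h))
    omega
  -- A window minimum is at most its first entry, and dropping that entry gives a shorter window
  -- starting one place later. These are the two step inequalities.
  refine le_tailCard_conjugatePartition H (fun k a => ∑ i ∈ Finset.Ico a N, windowMin H i k) hN
    (by simp) (fun k a => ?_) (fun k a => ?_) k
  · by_cases ha : a < N
    · rw [← Finset.sum_Ioo_add_eq_sum_Ico ha, add_comm]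
      exact Nat.add_le_add (windowMin_le_left H a k) le_rfl
    · simp [Finset.Ico_eq_empty_of_le (not_lt.mp ha)]
  · calc ∑ i ∈ Finset.Ico a N, windowMin H i (k + 1)
        ≤ ∑ i ∈ Finset.Ico a N, windowMin H (i + 1) k :=
          Finset.sum_le_sum fun i _ => by rw [windowMin_succ']; exact min_le_right _ _
      _ = ∑ i ∈ Finset.Ico (a + 1) (N + 1), windowMin H i k := by
          rw [Finset.sum_Ico_add' (fun i => windowMin H i k)]
      _ ≤ ∑ i ∈ Finset.Ico (a + 1) N, windowMin H i k := by
          by_cases ha : a + 1 ≤ N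
          · rw [Finset.sum_Ico_succ_top ha]
            have := windowMin_le_left H N k
            have := hz N le_rfl
            omega
          · rw [Finset.Ico_eq_empty_of_le (by omega)]
            simp

/-! ### Jordan types: ranks of powers and existence -/

open Polynomial

/-- The family indexed by all of `ℕ × ℕ` that extends a family indexed by the cells of `μ` by
zero. -/
noncomputable def extendCells {V : Type*} [Zero V] {μ : YoungDiagram}
    (b : {c : ℕ × ℕ // c ∈ μ} → V) (c : ℕ × ℕ) : V :=
  if h : c ∈ μ then b ⟨c, h⟩ else 0

/-- Extension by zero absorbs the case distinction at the end of a row, so the powers of f become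
plain shifts. -/
theorem map_extendCells {k V : Type*} [Field k] [AddCommGroup V] [Module k V]
    {f : V →ₗ[k] V} {μ : YoungDiagram} {b : {c : ℕ × ℕ // c ∈ μ} → V}
    (hb : ∀ c : {c : ℕ × ℕ // c ∈ μ},
      f (b c) = if h : (c.1.1, c.1.2 + 1) ∈ μ then b ⟨(c.1.1, c.1.2 + 1), h⟩ else 0)
    (n i j : ℕ) : (f ^ n) (extendCells b (i, j)) = extendCells b (i, j + n) := by
  induction n with
  | zero => rfl
  | succ n ih =>
    rw [pow_succ', Module.End.mul_apply, ih]
    by_cases h : (i, j + n) ∈ μ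
    · rw [extendCells, dif_pos h, hb]
      rfl
    · have h' : (i, j + (n + 1)) ∉ μ := fun h' => h (μ.up_left_mem le_rfl (by omega) h')
      rw [extendCells, dif_neg h, map_zero, extendCells, dif_neg h']

/-- The basis vectors in columns of index at least n are the images under f^n of those n places to
the left, and they are independent. The rank is in fact equal to the tail, but only this direction
is needed. -/
theorem IsJordanType.tailCard_le_finrank_range {k V : Type*} [Field k] [AddCommGroup V]
    [Module k V] [Module.Finite k V] {f : V →ₗ[k] V} {μ : YoungDiagram} (hf : IsJordanType f μ)
    (n : ℕ) : tailCard μ n ≤ Module.finrank k (LinearMap.range (f ^ n)) := by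
  obtain ⟨b, hb⟩ := hf
  let T : Finset (ℕ × ℕ) := μ.cells.filter fun c => n ≤ c.2
  have hmem : ∀ c : T, c.1 ∈ μ := fun c => (Finset.mem_filter.mp c.2).1
  have hr : ∀ c : T, extendCells b c.1 ∈ LinearMap.range (f ^ n) := fun c => by
    have hc : c.1 = (c.1.1, (c.1.2 - n) + n) := by
      rw [Nat.sub_add_cancel (Finset.mem_filter.mp c.2).2]
    rw [hc, ← map_extendCells hb]
    exact LinearMap.mem_range_self _ _
  have hli : LinearIndependent k fun c : T =>
      (⟨extendCells b c.1, hr c⟩ : LinearMap.range (f ^ n)) := by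
    apply LinearIndependent.of_comp (LinearMap.range (f ^ n)).subtype
    have hinj : Function.Injective fun c : T => (⟨c.1, hmem c⟩ : {c // c ∈ μ}) := fun c d h => by
      rw [Subtype.mk.injEq] at h
      exact Subtype.ext h
    convert! b.linearIndependent.comp _ hinj using 1
    ext c
    exact dif_pos (hmem c)
  have hcard := hli.fintype_card_le_finrank
  rwa [Fintype.card_coe] at hcard

theorem IsJordanType.card_eq_finrank {k V : Type*} [Field k] [AddCommGroup V]
    [Module k V] {f : V →ₗ[k] V} {μ : YoungDiagram} (hf : IsJordanType f μ) :
    μ.card = Module.finrank k V := by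
  obtain ⟨b, -⟩ := hf
  rw [Module.finrank_eq_nat_card_basis b]
  exact (Nat.card_eq_card_toFinset (μ.cells : Set (ℕ × ℕ))).symm ▸ (by simp)

theorem exists_isJordanType_of_antitone {k V : Type*} [Field k] [AddCommGroup V] [Module k V]
    {f : V →ₗ[k] V} {d : ℕ} {e : Fin d → ℕ} (he : Antitone e)
    (b : Module.Basis (Σ i, Fin (e i)) k V)
    (hb : ∀ i (j : Fin (e i)), f (b ⟨i, j⟩) =
      if h : j.1 + 1 < e i then b ⟨i, ⟨j.1 + 1, h⟩⟩ else 0) :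
    ∃ μ, IsJordanType f μ := by
  have hmem : ∀ c : ℕ × ℕ, c ∈ YoungDiagram.ofRowLens (List.ofFn e) he.sortedGE_ofFn ↔
      ∃ h : c.1 < d, c.2 < e ⟨c.1, h⟩ := fun c => by
    simp [YoungDiagram.mem_ofRowLens]
  let φ : (Σ i, Fin (e i)) ≃
      {c : ℕ × ℕ // c ∈ YoungDiagram.ofRowLens (List.ofFn e) he.sortedGE_ofFn} :=
    { toFun x := ⟨(x.1.1, x.2.1), (hmem _).mpr ⟨x.1.2, x.2.2⟩⟩
      invFun c := ⟨⟨c.1.1, ((hmem _).mp c.2).1⟩, ⟨c.1.2, ((hmem _).mp c.2).2⟩⟩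
      left_inv _ := rfl
      right_inv _ := rfl }
  refine ⟨_, b.reindex φ, fun c => ?_⟩
  rw [Module.Basis.reindex_apply]
  refine (hb _ _).trans ?_
  by_cases h : c.1.2 + 1 < e ⟨c.1.1, ((hmem _).mp c.2).1⟩
  · rw [dif_pos h, dif_pos ((hmem _).mpr ⟨_, h⟩), Module.Basis.reindex_apply]
    rfl
  · rw [dif_neg h, dif_neg fun h' => h ((hmem _).mp h').2]

theorem exists_isJordanType_of_basis {k V : Type*} [Field k] [AddCommGroup V] [Module k V]
    {f : V →ₗ[k] V} {d : ℕ} {e : Fin d → ℕ} (b : Module.Basis (Σ i, Fin (e i)) k V)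
    (hb : ∀ i (j : Fin (e i)), f (b ⟨i, j⟩) =
      if h : j.1 + 1 < e i then b ⟨i, ⟨j.1 + 1, h⟩⟩ else 0) :
    ∃ μ, IsJordanType f μ := by
  -- `Tuple.sort` orders the block sizes increasingly; the reversal makes them the rows of a Young
  -- diagram.
  let σ : Equiv.Perm (Fin d) := Fin.revPerm.trans (Tuple.sort e)
  have he : Antitone (e ∘ σ) := fun i j hij =>
    Tuple.monotone_sort e (Fin.rev_le_rev.mpr hij)
  let φ : (Σ i, Fin (e (σ i))) ≃ Σ i, Fin (e i) := Equiv.sigmaCongrLeft (β := fun i => Fin (e i)) σ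
  refine exists_isJordanType_of_antitone he (b.reindex φ.symm) fun i j => ?_
  simp only [Module.Basis.reindex_apply, Equiv.symm_symm]
  exact hb (σ i) j

/-- In the basis 1, X, ..., X^(n-1), multiplication by X is a single Jordan block. -/
theorem exists_basis_quotient_X_pow (k : Type*) [Field k] (n : ℕ) :
    ∃ b : Module.Basis (Fin n) k (k[X] ⧸ (Submodule.span k[X] {(X ^ n : k[X])})),
      ∀ j : Fin n, (X : k[X]) • b j = if h : j.1 + 1 < n then b ⟨j.1 + 1, h⟩ else 0 := by
  have h0 : (X ^ n : k[X]) ≠ 0 := pow_ne_zero n X_ne_zero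
  let pb := AdjoinRoot.powerBasis h0
  have hdim : pb.dim = n := by simp [pb]
  let b : Module.Basis (Fin n) k (AdjoinRoot (X ^ n : k[X])) := pb.basis.reindex (finCongr hdim)
  have hb : ∀ j, b j = AdjoinRoot.mk (X ^ n) (X ^ j.1) := fun j => by
    simp [b, pb]
  refine ⟨b, fun j => ?_⟩
  have hX : AdjoinRoot.mk (X ^ n) X * b j = AdjoinRoot.mk (X ^ n) (X ^ (j.1 + 1)) := by
    rw [hb, pow_succ', map_mul]
  refine hX.trans ?_
  split_ifs with h
  · exact (hb ⟨_, h⟩).symm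
  · exact AdjoinRoot.mk_eq_zero.mpr (pow_dvd_pow X (not_lt.mp h))

theorem dfinsuppBasis_apply {ι R : Type*} [Semiring R] [DecidableEq ι] {M : ι → Type*}
    [∀ i, AddCommMonoid (M i)] [∀ i, Module R (M i)] {η : ι → Type*}
    (b : ∀ i, Module.Basis (η i) R (M i)) (i : ι) (j : η i) :
    DFinsupp.basis b ⟨i, j⟩ = DFinsupp.single i (b i j) := by
  classical
  apply (DFinsupp.basis b).repr.injective
  rw [Module.Basis.repr_self]
  ext ⟨i', j'⟩
  simp only [DFinsupp.basis, LinearEquiv.trans_apply, sigmaFinsuppLequivDFinsupp_symm_apply,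
    DFinsupp.mapRange.linearEquiv_apply, DFinsupp.mapRange_single]
  by_cases h : i = i'
  · subst h
    simp [Finsupp.single_apply]
  · simp [h, DFinsupp.single_eq_of_ne (Ne.symm h)]

/-- Every nilpotent endomorphism of a finite-dimensional vector space has a Jordan type. -/
theorem exists_isJordanType {k V : Type*} [Field k] [AddCommGroup V] [Module k V]
    [Module.Finite k V] {f : V →ₗ[k] V} (hf : IsNilpotent f) : ∃ μ, IsJordanType f μ := by
  obtain ⟨n, hn⟩ := hf
  -- Regard V as a k[X]-module with X acting as f. Nilpotency makes it X-power torsion, hence a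
  -- direct sum of modules k[X]/(X^e).
  have : Module.Finite k (Module.AEval' f) := .equiv (Module.AEval'.of f)
  have : Module.Finite k[X] (Module.AEval' f) := .of_restrictScalars_finite k _ _
  have hX : ∀ (m : ℕ) (v : V),
      (X ^ m : k[X]) • Module.AEval'.of f v = Module.AEval'.of f ((f ^ m) v) := fun m v => by
    rw [Module.AEval'.X_pow_smul_of]; rfl
  have htors : Module.IsTorsion' (Module.AEval' f) (Submonoid.powers (X : k[X])) := by
    intro x
    refine ⟨⟨X ^ n, n, rfl⟩, ?_⟩
    obtain ⟨v, rfl⟩ := (Module.AEval'.of f).surjective x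
    exact (hX n v).trans (by simp [hn])
  obtain ⟨d, e, ⟨E⟩⟩ := Module.torsion_by_prime_power_decomposition
    (Polynomial.irreducible_X (R := k)) htors
  classical
  choose B hB using fun i => exists_basis_quotient_X_pow k (e i)
  let b : Module.Basis (Σ i, Fin (e i)) k V :=
    (DFinsupp.basis B).map
      ((E.restrictScalars k).symm.trans (Module.AEval'.of f).symm)
  have hb : ∀ i j, Module.AEval'.of f (b ⟨i, j⟩) = E.symm (DirectSum.lof k[X] _ _ i (B i j)) :=
    fun i j => by
      simp only [b, Module.Basis.map_apply, dfinsuppBasis_apply]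
      rfl
  refine exists_isJordanType_of_basis b fun i j => ?_
  apply (Module.AEval'.of f).injective
  rw [← Module.AEval'.X_smul_of, hb, ← map_smul, ← map_smul, hB]
  split_ifs with h
  · rw [hb]
  · simp

/-! ### Filtrations and adic Hilbert functions -/

theorem finiteSequence_apply {h : ℕ → ℕ} {N : ℕ} (hN : ∀ i, N ≤ i → h i = 0) (i : ℕ) :
    finiteSequence h i = h i := by
  have hf : (Function.support h).Finite := (Set.finite_lt_nat N).subset fun i hi => by
    by_contra h'
    exact hi (hN i (not_lt.mp h'))
  rw [finiteSequence, dif_pos hf]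
  rfl

theorem support_finiteSequence_subset {h : ℕ → ℕ} {N : ℕ} (hN : ∀ i, N ≤ i → h i = 0) :
    (finiteSequence h).support ⊆ Finset.range N := fun i hi => by
  rw [Finsupp.mem_support_iff, finiteSequence_apply hN] at hi
  by_contra h'
  exact hi (hN i (by simpa using h'))

/-- The filtration of `M` by the subspaces `I ^ i M`. -/
def adicFiltration (k : Type*) {A : Type*} [Field k] [CommRing A] [Algebra k A] (I : Ideal A)
    (M : Type*) [AddCommGroup M] [Module A M] [Module k M] [IsScalarTower k A M] (i : ℕ) :
    Submodule k M :=
  (I ^ i • (⊤ : Submodule A M)).restrictScalars k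

theorem finrank_associatedGradedPiece_add {k A M : Type*} [Field k] [CommRing A] [Algebra k A]
    [AddCommGroup M] [Module A M] [Module k M] [IsScalarTower k A M] [Module.Finite k M]
    (I : Ideal A) (i : ℕ) :
    Module.finrank k (AssociatedGradedPiece I M i) +
        Module.finrank k (adicFiltration k I M (i + 1)) =
      Module.finrank k (adicFiltration k I M i) := by
  have hle : (I ^ (i + 1) • (⊤ : Submodule A M)) ≤ I ^ i • (⊤ : Submodule A M) :=
    Submodule.smul_mono_left (Ideal.pow_le_pow_right i.le_succ)
  let P := (I ^ (i + 1) • (⊤ : Submodule A M)).submoduleOf (I ^ i • (⊤ : Submodule A M))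
  have e : P.restrictScalars k ≃ₗ[k] adicFiltration k I M (i + 1) :=
    (Submodule.submoduleOfEquivOfLe hle).restrictScalars k
  rw [← e.finrank_eq]
  have : Module.Finite k ↥(I ^ i • (⊤ : Submodule A M)) :=
    inferInstanceAs (Module.Finite k (adicFiltration k I M i))
  have h := Submodule.finrank_quotient_add_finrank (P.restrictScalars k)
  rw [(Submodule.Quotient.restrictScalarsEquiv k P).finrank_eq] at h
  exact h

/-- An endomorphism that moves every step of a filtration into the next one has a Jordan type
bounded by the conjugate of the sequence of the dimensions of the quotients. -/
theorem IsJordanType.dominanceLE_of_filtration {k V : Type*} [Field k] [AddCommGroup V] [Module k V]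
    [Module.Finite k V] {F : ℕ → Submodule k V} {H : ℕ →₀ ℕ} {N : ℕ}
    (hsupp : H.support ⊆ Finset.range N) (htop : F 0 = ⊤) (hbot : F N = ⊥)
    (hanti : ∀ i, F (i + 1) ≤ F i)
    (hstep : ∀ i, H i + Module.finrank k (F (i + 1)) = Module.finrank k (F i))
    {f : V →ₗ[k] V} (hmap : ∀ i, (F i).map f ≤ F (i + 1))
    {μ : YoungDiagram} (hμ : IsJordanType f μ) :
    DominanceLE μ (conjugatePartition H) := by
  apply dominanceLE_of_tailCard_le
  · rw [hμ.card_eq_finrank, card_conjugatePartition, Finset.sum_subset hsupp (by simp),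
      ← finrank_top k V, ← htop]
    have key : ∀ n, Module.finrank k (F 0) =
        ∑ i ∈ Finset.range n, H i + Module.finrank k (F n) := fun n => by
      induction n with
      | zero => simp
      | succ n ih =>
        rw [Finset.sum_range_succ, ih, ← hstep n]
        omega
    rw [key N, hbot, finrank_bot, add_zero]
  · intro j
    refine (hμ.tailCard_le_finrank_range j).trans ?_
    rw [LinearMap.range_eq_map, ← htop]
    refine le_tailCard_conjugatePartition _
      (fun j a => Module.finrank k ((F a).map (f ^ j))) hsupp ?_ ?_ ?_ j
    · intro j
      simp [hbot]
    · intro j a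
      -- A complement of F (a+1) in F a has dimension H a, so its image under f^j contributes at
      -- most H a.
      obtain ⟨C, hC⟩ := Submodule.exists_isCompl ((F (a + 1)).submoduleOf (F a))
      have hsup : F a = F (a + 1) ⊔ C.map (F a).subtype := by
        have h := congrArg (Submodule.map (F a).subtype) hC.sup_eq_top
        rw [Submodule.map_sup, Submodule.map_subtype_top, Submodule.submoduleOf,
          Submodule.map_comap_subtype, inf_eq_right.mpr (hanti a)] at h
        exact h.symm
      have hCr : Module.finrank k C = H a := by
        have h1 := Submodule.finrank_add_eq_of_isCompl hC
        rw [(Submodule.submoduleOfEquivOfLe (hanti a)).finrank_eq, ← hstep a] at h1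
        omega
      have h2 : Module.finrank k ((F a).map (f ^ j)) ≤
          Module.finrank k ((F (a + 1)).map (f ^ j)) +
            Module.finrank k ((C.map (F a).subtype).map (f ^ j)) := by
        conv_lhs => rw [hsup, Submodule.map_sup]
        exact Submodule.finrank_add_le_finrank_add_finrank _ _
      have h3 := (Submodule.finrank_map_le (f ^ j) (C.map (F a).subtype)).trans
        (Submodule.finrank_map_le (F a).subtype C)
      omega
    · intro j a
      rw [pow_succ, Module.End.mul_eq_comp, Submodule.map_comp]
      exact Submodule.finrank_mono (Submodule.map_mono (hmap a))

theorem adicFiltration_succ_le {k A M : Type*} [Field k] [CommRing A]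
    [Algebra k A] [AddCommGroup M] [Module A M] [Module k M] [IsScalarTower k A M]
    (I : Ideal A) (i : ℕ) : adicFiltration k I M (i + 1) ≤ adicFiltration k I M i := by
  have h : (I ^ (i + 1) • (⊤ : Submodule A M)) ≤ I ^ i • (⊤ : Submodule A M) :=
    Submodule.smul_mono_left (Ideal.pow_le_pow_right i.le_succ)
  exact fun x hx => h hx

theorem adicFiltration_zero {k A M : Type*} [Field k] [CommRing A]
    [Algebra k A] [AddCommGroup M] [Module A M] [Module k M] [IsScalarTower k A M]
    (I : Ideal A) : adicFiltration k I M 0 = ⊤ := by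
  simp [adicFiltration]

theorem adicFiltration_eq_bot {k A M : Type*} [Field k] [CommRing A]
    [Algebra k A] [AddCommGroup M] [Module A M] [Module k M] [IsScalarTower k A M]
    {I : Ideal A} {N i : ℕ} (hN : I ^ N = 0) (hi : N ≤ i) : adicFiltration k I M i = ⊥ := by
  have h0 : I ^ i = ⊥ := le_bot_iff.mp ((Ideal.pow_le_pow_right hi).trans_eq hN)
  rw [adicFiltration, h0, Submodule.bot_smul, Submodule.restrictScalars_bot]

theorem map_lsmul_adicFiltration_le {k A M : Type*} [Field k] [CommRing A]
    [Algebra k A] [AddCommGroup M] [Module A M] [Module k M] [IsScalarTower k A M]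
    {I : Ideal A} {ℓ : A} (hℓ : ℓ ∈ I) (i : ℕ) :
    (adicFiltration k I M i).map (Algebra.lsmul k k M ℓ) ≤ adicFiltration k I M (i + 1) := by
  rw [Submodule.map_le_iff_le_comap]
  intro x hx
  have h : ℓ • x ∈ I • (I ^ i • (⊤ : Submodule A M)) := Submodule.smul_mem_smul hℓ hx
  rw [← mul_smul, ← pow_succ'] at h
  exact h

/-- Multiplication by an element of a nilpotent ideal `I` has a Jordan type bounded by the conjugate
of the `I`-adic Hilbert function. -/
theorem IsJordanType.dominanceLE_adicHilbertFunction {k A M : Type*} [Field k] [CommRing A]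
    [Algebra k A] [AddCommGroup M] [Module A M] [Module k M] [IsScalarTower k A M]
    [Module.Finite k M] {I : Ideal A} (hI : IsNilpotent I) {ℓ : A} (hℓ : ℓ ∈ I)
    {μ : YoungDiagram} (hμ : IsJordanType (Algebra.lsmul k k M ℓ) μ) :
    DominanceLE μ (conjugatePartition (adicHilbertFunction k I M)) := by
  obtain ⟨N, hN⟩ := hI
  have hstep := finrank_associatedGradedPiece_add (k := k) (M := M) I
  have hzero : ∀ i, N ≤ i → Module.finrank k (AssociatedGradedPiece I M i) = 0 := fun i hi => by
    have := hstep i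
    rw [adicFiltration_eq_bot hN hi, finrank_bot] at this
    omega
  have hH : ∀ i, adicHilbertFunction k I M i = Module.finrank k (AssociatedGradedPiece I M i) :=
    finiteSequence_apply hzero
  have hsupp : (adicHilbertFunction k I M).support ⊆ Finset.range N :=
    support_finiteSequence_subset hzero
  exact hμ.dominanceLE_of_filtration hsupp (adicFiltration_zero I)
    (adicFiltration_eq_bot hN le_rfl) (adicFiltration_succ_le I) (fun i => by rw [hH]; exact hstep i) (map_lsmul_adicFiltration_le hℓ)

/-! ### Graded vector spaces -/

/-- An endomorphism that raises the degrees of a graded vector space by one has a Jordan type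
bounded by `barPartition H`, where `H` is the Hilbert function. -/
theorem IsJordanType.dominanceLE_gradedHilbertFunction {k M : Type*} [Field k] [AddCommGroup M]
    [Module k M] [Module.Finite k M] (ℳ : ℕ → Submodule k M) [DirectSum.Decomposition ℳ]
    {f : M →ₗ[k] M} (hf : ∀ i, (ℳ i).map f ≤ ℳ (i + 1))
    {μ : YoungDiagram} (hμ : IsJordanType f μ) :
    DominanceLE μ (barPartition (gradedHilbertFunction ℳ)) := by
  have hint := DirectSum.Decomposition.isInternal ℳ
  have hfin : {i | ℳ i ≠ ⊥}.Finite :=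
    WellFoundedGT.finite_ne_bot_of_iSupIndep hint.submodule_iSupIndep
  obtain ⟨N, hN⟩ := hfin.bddAbove
  have hbot : ∀ i, N + 1 ≤ i → ℳ i = ⊥ := fun i hi => by
    by_contra h
    have := hN h
    omega
  have hzero : ∀ i, N + 1 ≤ i → Module.finrank k (ℳ i) = 0 := fun i hi => by
    rw [hbot i hi, finrank_bot]
  have hH : ∀ i, gradedHilbertFunction ℳ i = Module.finrank k (ℳ i) := finiteSequence_apply hzero
  have hsupp : (gradedHilbertFunction ℳ).support ⊆ Finset.range (N + 1) :=
    support_finiteSequence_subset hzero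
  have htop : ⨆ i ∈ Finset.range (N + 1), ℳ i = ⊤ := by
    rw [eq_top_iff, ← hint.submodule_iSup_eq_top]
    refine iSup_le fun i => ?_
    by_cases hi : i ∈ Finset.range (N + 1)
    · exact le_iSup₂_of_le i hi le_rfl
    · rw [hbot i (by simpa using hi)]
      exact bot_le
  have hsum : ∀ (g : M →ₗ[k] M), Module.finrank k (LinearMap.range g) ≤
      ∑ i ∈ Finset.range (N + 1), Module.finrank k ((ℳ i).map g) := fun g => by
    have key : ∀ S : Finset ℕ, Module.finrank k ((⨆ i ∈ S, ℳ i).map g) ≤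
        ∑ i ∈ S, Module.finrank k ((ℳ i).map g) := fun S => by
      induction S using Finset.induction_on with
      | empty => simp
      | insert a S ha ih =>
        rw [Finset.iSup_insert, Submodule.map_sup, Finset.sum_insert ha]
        exact (Submodule.finrank_add_le_finrank_add_finrank _ _).trans (Nat.add_le_add_left ih _)
    rw [LinearMap.range_eq_map, ← htop]
    exact key _
  have hpow : ∀ j i, (ℳ i).map (f ^ j) ≤ ℳ (i + j) := fun j => by
    induction j with
    | zero => intro i; simp [Module.End.one_eq_id]
    | succ j ih =>
      intro i
      rw [pow_succ', Module.End.mul_eq_comp, Submodule.map_comp]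
      exact (Submodule.map_mono (ih i)).trans (hf _)
  apply dominanceLE_of_tailCard_le
  · rw [hμ.card_eq_finrank, card_barPartition,
      ← finrank_top k M, ← htop, Finset.sum_subset hsupp (by simp)]
    have key : ∀ S : Finset ℕ, Module.finrank k (⨆ i ∈ S, ℳ i : Submodule k M) =
        ∑ i ∈ S, Module.finrank k (ℳ i) := fun S => by
      induction S using Finset.induction_on with
      | empty => simp
      | insert a S ha ih =>
        have hd : Disjoint (ℳ a) (⨆ i ∈ S, ℳ i) :=
          hint.submodule_iSupIndep.disjoint_biSup (y := (S : Set ℕ)) (by simpa using ha)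
        have h := Submodule.finrank_sup_add_finrank_inf_eq (ℳ a) (⨆ i ∈ S, ℳ i)
        rw [hd.eq_bot, finrank_bot, add_zero, ih] at h
        rw [Finset.iSup_insert, Finset.sum_insert ha, h]
    simp only [hH]
    exact key _
  · intro j
    rw [tailCard_barPartition, rankBound_eq_sum_range _ hsupp]
    refine (hμ.tailCard_le_finrank_range j).trans ((hsum _).trans (Finset.sum_le_sum fun i _ => ?_))
    refine Finset.le_inf' _ _ fun m hm => ?_
    rw [Finset.mem_Icc] at hm
    rw [hH]
    obtain ⟨m, rfl⟩ := Nat.exists_eq_add_of_le hm.1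
    obtain ⟨n, rfl⟩ := Nat.exists_eq_add_of_le' (show m ≤ j by omega)
    -- The image of M_i under f^(n+m) is the image under f^n of a subspace of M_{i+m}, so its
    -- dimension is at most that of M_{i+m}, for each position in the window.
    rw [pow_add, Module.End.mul_eq_comp, Submodule.map_comp]
    exact (Submodule.finrank_map_le _ _).trans (Submodule.finrank_mono (hpow m i))

/-! ### Local and graded Artinian algebras -/

theorem moduleFinite_of_isFiniteLength {k A : Type*} [Field k] [CommRing A] [IsLocalRing A]
    [Algebra k A] (hk : Function.Surjective (algebraMap k (IsLocalRing.ResidueField A)))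
    (M : Type*) [AddCommGroup M] [Module A M] [Module k M] [IsScalarTower k A M]
    (hM : IsFiniteLength A M) : Module.Finite k M := by
  -- The induction varies the module, so its k-structure must be generalized. Each simple quotient
  -- is a copy of the residue field, which is finite over k.
  rename_i i1 i2
  revert i1 i2
  induction hM with
  | of_subsingleton => intros; infer_instance
  | @of_simple_quotient M _ _ N hN _ ih =>
    intro _ _
    have h1 : Module.Finite k (N.restrictScalars k) := ih
    obtain ⟨I, hI, ⟨e⟩⟩ := isSimpleModule_iff_quot_maximal.mp ‹IsSimpleModule A (M ⧸ N)›
    obtain rfl := IsLocalRing.eq_maximalIdeal hI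
    have h2 : Module.Finite k (A ⧸ IsLocalRing.maximalIdeal A) :=
      Module.Finite.of_surjective (Algebra.linearMap k (IsLocalRing.ResidueField A)) hk
    have h3 : Module.Finite k (M ⧸ N) := Module.Finite.equiv (e.restrictScalars k).symm
    have h4 : Module.Finite k (M ⧸ N.restrictScalars k) :=
      Module.Finite.equiv (Submodule.Quotient.restrictScalarsEquiv k N).symm
    exact Module.Finite.of_submodule_quotient (N.restrictScalars k)

/-- By the Artinian condition x^n = x^(n+1) y for some n and y. The right side has no component in
degree n*i, since x^(n+1) already has degree (n+1)*i; hence x^n = 0. -/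
theorem isNilpotent_of_mem_graded {k A : Type*} [Field k] [CommRing A] [Algebra k A]
    [IsArtinianRing A] (𝒜 : ℕ → Submodule k A) [GradedAlgebra 𝒜] {i : ℕ} (hi : 0 < i) {x : A}
    (hx : x ∈ 𝒜 i) : IsNilpotent x := by
  obtain ⟨n, y, h⟩ := IsArtinian.exists_pow_succ_smul_dvd x (1 : A)
  refine ⟨n, ?_⟩
  rw [smul_eq_mul, smul_eq_mul, mul_one] at h
  have h1 : x ^ n ∈ 𝒜 (n • i) := SetLike.pow_mem_graded n hx
  have h2 : x ^ n.succ ∈ 𝒜 (n.succ • i) := SetLike.pow_mem_graded n.succ hx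
  have h3 := DirectSum.coe_decompose_mul_of_left_mem_of_not_le (b := y) (n := n • i) 𝒜 h2
    (by simp only [smul_eq_mul, Nat.succ_mul]; omega)
  rwa [h, DirectSum.decompose_of_mem_same 𝒜 h1] at h3

theorem irrelevant_le_nilradical {k A : Type*} [Field k] [CommRing A] [Algebra k A]
    [IsArtinianRing A] (𝒜 : ℕ → Submodule k A) [GradedAlgebra 𝒜] :
    (HomogeneousIdeal.irrelevant 𝒜).toIdeal ≤ nilradical A := by
  rw [HomogeneousIdeal.toIdeal_irrelevant_le]
  intro i hi x hx
  exact isNilpotent_of_mem_graded 𝒜 hi hx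

theorem exists_algebraMap_add_irrelevant {k A : Type*} [Field k] [CommRing A] [Algebra k A]
    (𝒜 : ℕ → Submodule k A) [GradedAlgebra 𝒜]
    (h0 : 𝒜 0 = LinearMap.range (Algebra.linearMap k A)) (a : A) :
    ∃ c : k, a - algebraMap k A c ∈ HomogeneousIdeal.irrelevant 𝒜 := by
  obtain ⟨c, hc⟩ := h0.le (DirectSum.decompose 𝒜 a 0).2
  have hc' : algebraMap k A c = DirectSum.decompose 𝒜 a 0 := hc
  refine ⟨c, ?_⟩
  rw [HomogeneousIdeal.mem_irrelevant_iff, hc', GradedRing.proj_apply, DirectSum.decompose_sub,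
    DirectSum.decompose_coe]
  simp

/-- An element is a scalar plus a nilpotent element of A_+, so it is a unit as soon as the scalar is
nonzero. -/
theorem isUnit_or_mem_irrelevant {k A : Type*} [Field k] [CommRing A] [Algebra k A]
    [IsArtinianRing A] (𝒜 : ℕ → Submodule k A) [GradedAlgebra 𝒜]
    (h0 : 𝒜 0 = LinearMap.range (Algebra.linearMap k A)) (a : A) :
    IsUnit a ∨ a ∈ HomogeneousIdeal.irrelevant 𝒜 := by
  obtain ⟨c, hc⟩ := exists_algebraMap_add_irrelevant 𝒜 h0 a
  by_cases h : c = 0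
  · right
    simpa [h] using hc
  · left
    have hu : IsUnit (algebraMap k A c) := (IsUnit.mk0 c h).map _
    have hn : IsNilpotent (a - algebraMap k A c) := irrelevant_le_nilradical 𝒜 hc
    have := hn.isUnit_add_left_of_commute hu (Commute.all _ _)
    rwa [add_sub_cancel] at this

theorem isLocalRing_of_graded {k A : Type*} [Field k] [CommRing A] [Nontrivial A] [Algebra k A]
    [IsArtinianRing A] (𝒜 : ℕ → Submodule k A) [GradedAlgebra 𝒜]
    (h0 : 𝒜 0 = LinearMap.range (Algebra.linearMap k A)) : IsLocalRing A := by
  refine IsLocalRing.of_isUnit_or_isUnit_one_sub_self fun a => ?_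
  refine (isUnit_or_mem_irrelevant 𝒜 h0 a).imp_right fun ha => ?_
  exact IsNilpotent.isUnit_one_sub (irrelevant_le_nilradical 𝒜 ha)

theorem maximalIdeal_eq_irrelevant {k A : Type*} [Field k] [CommRing A] [IsLocalRing A]
    [Algebra k A] [IsArtinianRing A] (𝒜 : ℕ → Submodule k A) [GradedAlgebra 𝒜]
    (h0 : 𝒜 0 = LinearMap.range (Algebra.linearMap k A)) :
    IsLocalRing.maximalIdeal A = (HomogeneousIdeal.irrelevant 𝒜).toIdeal := by
  refine le_antisymm (fun a ha => ?_)
    ((irrelevant_le_nilradical 𝒜).trans (nilradical_le_prime _))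
  exact (isUnit_or_mem_irrelevant 𝒜 h0 a).resolve_left ha

theorem residueField_surjective_of_graded {k A : Type*} [Field k] [CommRing A] [IsLocalRing A]
    [Algebra k A] [IsArtinianRing A] (𝒜 : ℕ → Submodule k A) [GradedAlgebra 𝒜]
    (h0 : 𝒜 0 = LinearMap.range (Algebra.linearMap k A)) :
    Function.Surjective (algebraMap k (IsLocalRing.ResidueField A)) := by
  intro x
  obtain ⟨a, rfl⟩ := IsLocalRing.residue_surjective x
  obtain ⟨c, hc⟩ := exists_algebraMap_add_irrelevant 𝒜 h0 a
  refine ⟨c, ?_⟩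
  have hm : a - algebraMap k A c ∈ IsLocalRing.maximalIdeal A := by
    rw [maximalIdeal_eq_irrelevant 𝒜 h0]
    exact hc
  have h := (IsLocalRing.residue_eq_zero_iff _).mpr hm
  rw [map_sub, sub_eq_zero] at h
  exact h.symm

/-- Multiplication by an element of the maximal ideal of a local Artinian algebra. -/
theorem isJordanType_lsmul_of_mem_maximalIdeal {k A : Type*} [Field k] [CommRing A] [IsLocalRing A]
    [Algebra k A] [IsArtinianRing A]
    (hk : Function.Surjective (algebraMap k (IsLocalRing.ResidueField A)))
    (M : Type*) [AddCommGroup M] [Module A M] [Module k M] [IsScalarTower k A M]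
    (hM : IsFiniteLength A M) {ℓ : A} (hℓ : ℓ ∈ IsLocalRing.maximalIdeal A) :
    (∃ μ, IsJordanType (Algebra.lsmul k k M ℓ) μ) ∧
      ∀ μ, IsJordanType (Algebra.lsmul k k M ℓ) μ →
        DominanceLE μ
          (conjugatePartition (adicHilbertFunction k (IsLocalRing.maximalIdeal A) M)) := by
  have hfin : Module.Finite k M := moduleFinite_of_isFiniteLength hk M hM
  have hnil : IsNilpotent (IsLocalRing.maximalIdeal A) := by
    have h := IsArtinianRing.isNilpotent_jacobson_bot (R := A)
    rwa [IsLocalRing.jacobson_eq_maximalIdeal ⊥ bot_ne_top] at h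
  refine ⟨exists_isJordanType ?_, fun μ hμ => hμ.dominanceLE_adicHilbertFunction hnil hℓ⟩
  obtain ⟨n, hn⟩ := hnil
  have h0 : ℓ ^ n = 0 := by
    have := Ideal.pow_mem_pow hℓ n
    rwa [hn, Ideal.zero_eq_bot, Ideal.mem_bot] at this
  exact ⟨n, by rw [← map_pow, h0, map_zero]⟩

end JordanHilbert

theorem theorem2p10 (k : Type*) [Field k] :
    -- graded algebras
    (∀ (A : Type*) [CommRing A] [Nontrivial A] [Algebra k A] [IsArtinianRing A]
      (𝒜 : ℕ → Submodule k A) [GradedAlgebra 𝒜],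
      𝒜 0 = LinearMap.range (Algebra.linearMap k A) →
      -- linear elements acting on graded modules
      (∀ (M : Type*) [AddCommGroup M] [Module A M] [Module k M] [IsScalarTower k A M]
        (ℳ : ℕ → Submodule k M) [DirectSum.Decomposition ℳ] [SetLike.GradedSMul 𝒜 ℳ],
        IsFiniteLength A M →
        ∀ ℓ ∈ 𝒜 1,
          (∃ μ, JordanHilbert.IsJordanType (Algebra.lsmul k k M ℓ) μ) ∧
          (∀ μ, JordanHilbert.IsJordanType (Algebra.lsmul k k M ℓ) μ →
            JordanHilbert.DominanceLE μ
              (JordanHilbert.barPartition (JordanHilbert.gradedHilbertFunction ℳ))) ∧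
          JordanHilbert.DominanceLE
            (JordanHilbert.barPartition (JordanHilbert.gradedHilbertFunction ℳ))
            (JordanHilbert.conjugatePartition (JordanHilbert.gradedHilbertFunction ℳ))) ∧
      -- arbitrary elements of the maximal ideal acting on the algebra
      (∀ ℓ ∈ (HomogeneousIdeal.irrelevant 𝒜).toIdeal,
          (∃ μ, JordanHilbert.IsJordanType (Algebra.lsmul k k A ℓ) μ) ∧
          ∀ μ, JordanHilbert.IsJordanType (Algebra.lsmul k k A ℓ) μ →
            JordanHilbert.DominanceLE μ
              (JordanHilbert.conjugatePartition
                (JordanHilbert.adicHilbertFunction k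
                  (HomogeneousIdeal.irrelevant 𝒜).toIdeal A)))) ∧
    -- local algebras
    (∀ (A : Type*) [CommRing A] [IsLocalRing A] [Algebra k A] [IsArtinianRing A],
      Function.Bijective (algebraMap k (IsLocalRing.ResidueField A)) →
      ∀ (M : Type*) [AddCommGroup M] [Module A M] [Module k M] [IsScalarTower k A M],
        IsFiniteLength A M →
        ∀ ℓ ∈ IsLocalRing.maximalIdeal A,
          (∃ μ, JordanHilbert.IsJordanType (Algebra.lsmul k k M ℓ) μ) ∧
          ∀ μ, JordanHilbert.IsJordanType (Algebra.lsmul k k M ℓ) μ →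
            JordanHilbert.DominanceLE μ
              (JordanHilbert.conjugatePartition
                (JordanHilbert.adicHilbertFunction k (IsLocalRing.maximalIdeal A) M))) := by

  refine ⟨fun A _ _ _ _ 𝒜 _ h0 => ?_, fun A _ _ _ _ hk M _ _ _ _ hM ℓ hℓ =>
    JordanHilbert.isJordanType_lsmul_of_mem_maximalIdeal hk.2 M hM hℓ⟩
  -- Locality reduces existence of the Jordan type and the bound for arbitrary elements of A_+ to
  -- the local case.
  have hloc : IsLocalRing A := JordanHilbert.isLocalRing_of_graded 𝒜 h0
  have hk := JordanHilbert.residueField_surjective_of_graded 𝒜 h0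
  have hmax := JordanHilbert.maximalIdeal_eq_irrelevant 𝒜 h0
  refine ⟨fun M _ _ _ _ ℳ _ _ hM ℓ hℓ => ⟨?_, fun μ hμ => ?_,
    JordanHilbert.barPartition_dominanceLE_conjugatePartition _⟩, fun ℓ hℓ => ?_⟩
  · refine (JordanHilbert.isJordanType_lsmul_of_mem_maximalIdeal hk M hM ?_).1
    rw [hmax]
    exact HomogeneousIdeal.mem_irrelevant_of_mem 𝒜 Nat.zero_lt_one hℓ
  · have hfin := JordanHilbert.moduleFinite_of_isFiniteLength hk M hM
    refine hμ.dominanceLE_gradedHilbertFunction ℳ fun i => ?_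
    rintro _ ⟨x, hx, rfl⟩
    have h := SetLike.GradedSMul.smul_mem hℓ hx
    rwa [vadd_eq_add, add_comm] at h
  · rw [← hmax] at hℓ ⊢
    exact JordanHilbert.isJordanType_lsmul_of_mem_maximalIdeal hk A
      (isFiniteLength_iff_isNoetherian_isArtinian.mpr ⟨inferInstance, inferInstance⟩) hℓ
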